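/- For each $m\ge 1$ let $X_m=s_m+N_m$ be a real $n_m\times p_m$ matrix, where $s_m$ is a deterministic signal and $N_m$ is a random noise matrix whose columns are independent, each with a spherical distribution (invariant under all orthogonal maps of $\mathbb R^{n_m}$); the columns need not be identically distributed. Suppose that $n_m,p_m\to\infty$ with $c_0\le n_m/p_m\le c_1$ for fixed $0<c_0<c_1$. Write $\|\cdot\|_{\mathrm{op}}$ for the largest singular value and $\|\cdot\|_{2,\infty}$ for the largest Euclidean norm of a column. Fix $\alpha\in(0,1]$ and a number $K$ of random transformations with $1/(K+1)\le\alpha$. The group $\mathcal G_m=O(n_m)\times\cdots\times O(n_m)$ ($p_m$ factors) acts on $n_m\times p_m$ matrices by applying the $j$-th orthogonal matrix to the $j$-th column. Let $G_{m1},\dots,G_{mK}$ be i.i.d. uniform (Haar) on $\mathcal G_m$ and independent of $N_m$. The randomization test of $s_m=0$ rejects if $$\|X_m\|_{\mathrm{op}}>f_{(k)},\qquad k=\lceil(1-\alpha)(K+1)\rceil,$$ where $f_{(1)}\le\dots\le f_{(K+1)}$ are the ordered values of $\|X_m\|_{\mathrm{op}},\|G_{m1}X_m\|_{\mathrm{op}},\dots,\|G_{mK}X_m\|_{\mathrm{op}}$,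 and $f_{(0)}=-\infty$. For each $m$ let $\Theta_{m1}$ be a set of real $n_m\times p_m$ matrices. Suppose that there is a deterministic sequence $(t_{m,2})_{m\ge1}$ of real numbers with $$P\bigl(\|N_m\|_{2,\infty}\le t_{m,2}\bigr)\to1$$ such that, for every sequence $(s_m)_{m\ge1}$ with $s_m\in\Theta_{m1}$ for all $m\ge 1$, $$\liminf_{m\to\infty}\frac{\|s_m\|_{\mathrm{op}}/(n_m^{1/2}+p_m^{1/2})}{(\|s_m\|_{2,\infty}+2t_{m,2})/n_m^{1/2}}>2$$ (the liminf may be $+\infty$; a quotient $0/0$ is read as $0$). Then the sequence of randomization tests is consistent against these alternatives: for every sequence $(s_m)_{m\ge1}$ with $s_m\in\Theta_{m1}$ for all $m\ge 1$, the probability, over $N_m$ and $G_{m1},\dots,G_{mK}$, that the test rejects on $X_m=s_m+N_m$ tends to $1$ as $m\to\infty$. -/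

import Mathlib

open Filter Topology MeasureTheory ProbabilityTheory

/-! ### Uniform distribution on the orthogonal group -/

/-- The orthogonal group `O(n)` of real `n × n` orthogonal matrices. -/
abbrev OrthGroup (n : ℕ) : Type := Matrix.orthogonalGroup (Fin n) ℝ

instance orthGroupMeasurableSpace (n : ℕ) : MeasurableSpace (OrthGroup n) := borel _

instance orthGroupBorelSpace (n : ℕ) : BorelSpace (OrthGroup n) := ⟨rfl⟩

instance orthGroupCompactSpace (n : ℕ) : CompactSpace (OrthGroup n) := by
  have hclosed : IsClosed {A : Matrix (Fin n) (Fin n) ℝ | A ∈ Matrix.orthogonalGroup (Fin n) ℝ} := by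
    have h : {A : Matrix (Fin n) (Fin n) ℝ | A ∈ Matrix.orthogonalGroup (Fin n) ℝ}
        = {A | A * star A = 1} := by
      ext A
      exact Matrix.mem_orthogonalGroup_iff (Fin n) ℝ
    rw [h]
    exact isClosed_eq (by fun_prop) continuous_const
  have hK : IsCompact (Set.pi Set.univ fun _ : Fin n => Set.pi Set.univ fun _ : Fin n =>
      Set.Icc (-1 : ℝ) 1) :=
    isCompact_univ_pi fun _ => isCompact_univ_pi fun _ => isCompact_Icc
  refine isCompact_iff_compactSpace.mp (IsCompact.of_isClosed_subset hK hclosed ?_)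
  intro A hA i _ j _
  have h := entry_norm_bound_of_unitary (𝕜 := ℝ) (n := Fin n) (U := A) hA i j
  exact abs_le.mp (by simpa [Real.norm_eq_abs] using h)

/-- The uniform distribution (Haar probability measure) on `O(n)`. -/
noncomputable def haarOrth (n : ℕ) : Measure (OrthGroup n) :=
  Measure.haarMeasure (⊤ : TopologicalSpace.PositiveCompacts (OrthGroup n))

instance haarOrthIsProbabilityMeasure (n : ℕ) : IsProbabilityMeasure (haarOrth n) := by
  refine ⟨?_⟩
  have h := Measure.haarMeasure_self (K₀ := (⊤ : TopologicalSpace.PositiveCompacts (OrthGroup n)))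
  rwa [TopologicalSpace.PositiveCompacts.coe_top] at h

/-- The uniform distribution on the direct product `O(n) × ⋯ × O(n)` (`p` factors): the `p`
rotations are independent and each is uniform on `O(n)`. -/
noncomputable def haarColumns (n p : ℕ) : Measure (Fin p → OrthGroup n) :=
  Measure.pi fun _ => haarOrth n

/-- The action of `O(n) × ⋯ × O(n)` on `n × p` matrices: the `j`-th rotation is applied to the
`j`-th column. -/
def rotateColumns {n p : ℕ} (g : Fin p → OrthGroup n) (X : Matrix (Fin n) (Fin p) ℝ) :
    Matrix (Fin n) (Fin p) ℝ :=
  Matrix.of fun i j => ((g j : Matrix (Fin n) (Fin n) ℝ).mulVec fun l => X l j) i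

/-! ### Matrix norms and spherical distributions -/

open scoped Matrix.Norms.L2Operator in
/-- The operator norm (largest singular value) of a real `n × p` matrix, with respect to the
Euclidean norms. -/
noncomputable def matOpNorm {n p : ℕ} (X : Matrix (Fin n) (Fin p) ℝ) : ℝ := ‖X‖

/-- The maximum of the Euclidean norms of the columns of `X`. -/
noncomputable def maxColNorm {n p : ℕ} (X : Matrix (Fin n) (Fin p) ℝ) : ℝ :=
  ⨆ j : Fin p, ‖WithLp.toLp 2 fun i : Fin n => X i j‖

/-- A distribution on `ℝⁿ` is spherical if it is invariant under all orthogonal maps. -/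
def IsSpherical {n : ℕ} (μ : Measure (Fin n → ℝ)) : Prop :=
  ∀ Q ∈ Matrix.orthogonalGroup (Fin n) ℝ, μ.map (fun v => Q.mulVec v) = μ

/-- The columns of the random matrix `N` are independent, and each has a spherical distribution. -/
def HasIndepSphericalColumns {Ω : Type*} [MeasurableSpace Ω] {n p : ℕ}
    (N : Ω → Matrix (Fin n) (Fin p) ℝ) (P : Measure Ω) : Prop :=
  iIndepFun (fun (j : Fin p) (ω : Ω) (i : Fin n) => N ω i j) P ∧
    ∀ j : Fin p, IsSpherical (P.map fun (ω : Ω) (i : Fin n) => N ω i j)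

/-! ### Randomization tests -/

/-- The order statistic `v₍ₖ₎`, i.e. the `k`-th smallest (`k = 1, …, n`) of the `n` numbers
`v 0, …, v (n-1)`, with the conventions `v₍₀₎ = -∞` and `v₍ₖ₎ = ∞` for `k > n`. -/
noncomputable def orderStat {n : ℕ} (v : Fin n → ℝ) : ℕ → EReal
  | 0 => ⊥
  | k + 1 => if h : k < n then ((v (Tuple.sort v ⟨k, h⟩) : ℝ) : EReal) else ⊤

/-- The rejection event of the randomization test with statistic `f` and group elements
`g 0, …, g (K-1)` acting through `act`: with `k = ⌈(1 - α)(K + 1)⌉`, the null hypothesis is rejected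
if `f x` exceeds the `k`-th smallest of the `K + 1` numbers `f x, f (g₁ x), …, f (g_K x)`. -/
def RandomizationRejects {V G : Type*} (f : V → ℝ) (act : G → V → V) (α : ℝ) {K : ℕ}
    (x : V) (g : Fin K → G) : Prop :=
  orderStat (Fin.cons (f x) fun i : Fin K => f (act (g i) x) : Fin (K + 1) → ℝ)
    ⌈(1 - α) * ((K : ℝ) + 1)⌉₊ < (f x : EReal)

/-- The probability that the operator norm randomization test at level `α`, with `K` independent
uniformly distributed elements of `O(n) × ⋯ × O(n)` rotating the columns (independent of the noise),
rejects the null hypothesis on the data `X = s + N`, where the noise `N` is defined on `(Ω, P)`. -/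
noncomputable def rejectionProb {Ω : Type*} [MeasurableSpace Ω] (P : Measure Ω) {n p : ℕ}
    (N : Ω → Matrix (Fin n) (Fin p) ℝ) (α : ℝ) (K : ℕ) (s : Matrix (Fin n) (Fin p) ℝ) : ENNReal :=
  (P.prod (Measure.pi fun _ : Fin K => haarColumns n p))
    {z | RandomizationRejects matOpNorm rotateColumns α (s + N z.1) z.2}

/-- Consistency of the sequence of tests against the sequence of alternatives `s m ∈ Θ m`: along every
such sequence of signals, the rejection probability tends to one. -/
def IsConsistentAgainst {Ω : ℕ → Type*} [∀ m, MeasurableSpace (Ω m)] (P : ∀ m, Measure (Ω m))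
    {n p : ℕ → ℕ} (N : ∀ m, Ω m → Matrix (Fin (n m)) (Fin (p m)) ℝ) (α : ℝ) (K : ℕ)
    (Θ : ∀ m, Set (Matrix (Fin (n m)) (Fin (p m)) ℝ)) : Prop :=
  ∀ s : ∀ m, Matrix (Fin (n m)) (Fin (p m)) ℝ, (∀ m, s m ∈ Θ m) →
    Tendsto (fun m => rejectionProb (P m) (N m) α K (s m)) atTop (𝓝 1)

/-! Put `c = (√n + √p) / √n`. The heart is a bound for a fixed matrix `X` with column norms at most
`M`: after independent uniform rotations of its columns, its operator norm exceeds `2 M c` with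
probability at most `(9/10) ^ ⌈√(np)⌉` (`haarColumns_lt_matOpNorm_le`).

A moment argument replaces the usual net on the sphere. For a uniform unit vector `u` independent of
the rotated matrix `W`, compute `𝔼 |uᵀW| ^ (2k)` in two ways. Given `W`, Cauchy–Schwarz against a
near-maximizing direction bounds it below by about `‖W‖ ^ (2k)` times the `2k`-th moment of one
coordinate of `u` (`pow_mul_le_integral_of_lt_matOpNorm`). Given `u`, `|uᵀW|²` is a sum of `p`
independent terms whose moments are dominated by those of `M²/n` times a chi-square variable
(`integral_vecMul_rotateColumns_pow_le`). All these moments are products `x (x + 2) ⋯ (x + 2(k -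
1))`, the `k`-th chi-square moment with `x` degrees of freedom. Markov's inequality with `k =
⌈√(np)⌉` finishes.

Spherical noise has the same law as its rotations, so the bound also controls `‖N‖`. With high
probability `‖N‖ ≤ 2 t c` and every rotated statistic is at most `2 (‖s‖₂,∞ + t) c`, while the
signal condition makes `‖s + N‖` strictly larger. The observed statistic is then the strict maximum
and the test rejects. -/

/-! ### Even moments of the uniform distribution on a sphere -/

open Matrix in
/-- Two vectors of the same Euclidean norm are mapped to each other by an orthogonal matrix
(a Householder reflection). -/
theorem exists_orthogonal_mulVec_eq {n : ℕ} (u v : Fin n → ℝ) (h : u ⬝ᵥ u = v ⬝ᵥ v) :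
    ∃ R ∈ Matrix.orthogonalGroup (Fin n) ℝ, Rᵀ *ᵥ u = v := by
  set w := u - v with hw
  -- If `u = v`, division by zero gives `c = 0` and the reflection becomes the identity; `hcw`,
  -- which yields orthogonality, still holds.
  set c : ℝ := 2 / (w ⬝ᵥ w) with hc
  have hcw : c * c * (w ⬝ᵥ w) = 2 * c := by
    by_cases h0 : w ⬝ᵥ w = 0
    · simp [hc, h0]
    · rw [hc]; field_simp
  have hT : (1 - c • vecMulVec w w)ᵀ = 1 - c • vecMulVec w w := by
    simp [transpose_sub, transpose_smul, transpose_vecMulVec]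
  refine ⟨1 - c • vecMulVec w w, ?_, ?_⟩
  · rw [Matrix.mem_orthogonalGroup_iff, hT, sub_mul, mul_sub, mul_sub, smul_mul_smul_comm, vecMulVec_mul_vecMulVec, vecMulVec_smul]
    rw [smul_smul, hcw, mul_one, one_mul, mul_one, mul_smul, two_smul]
    abel
  · rw [hT, sub_mulVec, one_mulVec, smul_mulVec, vecMulVec_mulVec]
    by_cases h0 : w ⬝ᵥ w = 0
    · have : w = 0 := dotProduct_self_eq_zero.mp h0
      rw [this]; simp [← sub_eq_zero, ← hw, this]
    · have hww : w ⬝ᵥ w = 2 * (w ⬝ᵥ u) := by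
        have hvu : v ⬝ᵥ u = u ⬝ᵥ v := dotProduct_comm _ _
        simp only [hw, sub_dotProduct, dotProduct_sub] at *
        linarith
      have : c * (w ⬝ᵥ u) = 1 := by
        rw [hc, hww, div_mul_eq_mul_div, div_self (hww ▸ h0)]
      rw [op_smul_eq_smul, smul_smul, this, one_smul, hw]; abel

instance haarOrthIsMulLeftInvariant (n : ℕ) : (haarOrth n).IsMulLeftInvariant := by
  unfold haarOrth; infer_instance

instance orthGroupSecondCountable (n : ℕ) : SecondCountableTopology (OrthGroup n) :=
  haveI : SecondCountableTopology (Matrix (Fin n) (Fin n) ℝ) :=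
    inferInstanceAs (SecondCountableTopology (Fin n → Fin n → ℝ))
  TopologicalSpace.Subtype.secondCountableTopology
    (Matrix.orthogonalGroup (Fin n) ℝ : Set (Matrix (Fin n) (Fin n) ℝ))

theorem Continuous.integrable_of_compactSpace {Y : Type*} [TopologicalSpace Y] [CompactSpace Y]
    [MeasurableSpace Y] [OpensMeasurableSpace Y] {μ : Measure Y} [IsFiniteMeasure μ]
    {f : Y → ℝ} (hf : Continuous f) : Integrable f μ :=
  hf.integrable_of_hasCompactSupport (HasCompactSupport.of_compactSpace f)

open Matrix in
theorem continuous_orth_mulVec {n : ℕ} (x : Fin n → ℝ) :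
    Continuous fun Q : OrthGroup n => Q.1 *ᵥ x := by
  fun_prop

open Matrix in
theorem orth_mulVec_dotProduct_self {n : ℕ} (Q : OrthGroup n) (x : Fin n → ℝ) :
    (Q.1 *ᵥ x) ⬝ᵥ (Q.1 *ᵥ x) = x ⬝ᵥ x := by
  have h := (Matrix.mem_orthogonalGroup_iff' (Fin n) ℝ).mp Q.2
  rw [dotProduct_mulVec, vecMul_mulVec, h, vecMul_one]

open Matrix in
/-- The integral of a function of `⟨u, Q x⟩` over the orthogonal group depends on `u` only
through its norm. -/
theorem integral_haarOrth_dotProduct_congr {n : ℕ} (f : ℝ → ℝ) (u v x : Fin n → ℝ)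
    (h : u ⬝ᵥ u = v ⬝ᵥ v) :
    ∫ Q : OrthGroup n, f (u ⬝ᵥ (Q.1 *ᵥ x)) ∂haarOrth n =
      ∫ Q : OrthGroup n, f (v ⬝ᵥ (Q.1 *ᵥ x)) ∂haarOrth n := by
  obtain ⟨R, hR, hRu⟩ := exists_orthogonal_mulVec_eq u v h
  -- Replacing `Q` by `R Q` lets `R` pass to the other factor as `Rᵀ`, which sends `u` to `v`.
  rw [← integral_mul_left_eq_self _ (⟨R, hR⟩ : OrthGroup n)]
  congr 1 with Q
  congr 1
  rw [← hRu, mulVec_transpose, Submonoid.coe_mul, ← mulVec_mulVec, dotProduct_mulVec]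

/-- The moment `𝔼 (Q x)₀ ^ (2 k)` for `Q` uniform on `O(n + 1)`. -/
noncomputable def firstCoordMoment {n : ℕ} (x : Fin (n + 1) → ℝ) (k : ℕ) : ℝ :=
  ∫ Q : OrthGroup (n + 1), (Q.1.mulVec x 0) ^ (2 * k) ∂haarOrth (n + 1)

open Matrix in
theorem integral_haarOrth_dotProduct_pow {n : ℕ} (u x : Fin (n + 1) → ℝ) (k : ℕ) :
    ∫ Q : OrthGroup (n + 1), (u ⬝ᵥ (Q.1 *ᵥ x)) ^ (2 * k) ∂haarOrth (n + 1) =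
      (u ⬝ᵥ u) ^ k * firstCoordMoment x k := by
  have h0 : 0 ≤ u ⬝ᵥ u := Finset.sum_nonneg fun i _ => mul_self_nonneg (u i)
  rw [integral_haarOrth_dotProduct_congr (fun r => r ^ (2 * k)) u
    (Pi.single 0 (√(u ⬝ᵥ u))) x (by simp [Real.mul_self_sqrt h0])]
  simp only [single_dotProduct, mul_pow, integral_const_mul]
  rw [pow_mul (√(u ⬝ᵥ u)), Real.sq_sqrt h0, firstCoordMoment]

-- Both sides of `h` are polynomials in `t`. Their coefficients of `t ^ 2` are `(2k+2 choose 2) =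
-- (k+1)(2k+1)` times the mixed moment, and `(k+1) c`. This turns rotation invariance into a
-- relation between mixed and pure moments.
open Polynomial in
theorem coeff_two_of_integral_add_mul_pow {Y : Type*} [MeasurableSpace Y] {μ : Measure Y}
    {a b : Y → ℝ} (hab : ∀ i j, Integrable (fun y => a y ^ i * b y ^ j) μ) {k : ℕ} {c : ℝ}
    (h : ∀ t : ℝ, ∫ y, (a y + t * b y) ^ (2 * (k + 1)) ∂μ = (1 + t ^ 2) ^ (k + 1) * c) :
    (2 * k + 1) * ∫ y, a y ^ (2 * k) * b y ^ 2 ∂μ = c := by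
  have hpoly : ∑ j ∈ Finset.range (2 * (k + 1) + 1),
      C ((∫ y, b y ^ j * a y ^ (2 * (k + 1) - j) ∂μ) * ((2 * (k + 1)).choose j : ℝ)) *
        (X : ℝ[X]) ^ j = expand ℝ 2 ((1 + X) ^ (k + 1)) * C c := by
    refine Polynomial.funext fun t => ?_
    rw [eval_finsetSum]
    simp only [eval_mul, eval_C, eval_pow, eval_X, expand_eval, eval_add, eval_one]
    rw [← h t]
    have hexp : ∀ y, (a y + t * b y) ^ (2 * (k + 1)) = ∑ j ∈ Finset.range (2 * (k + 1) + 1),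
        (b y ^ j * a y ^ (2 * (k + 1) - j)) * (((2 * (k + 1)).choose j : ℝ) * t ^ j) := by
      intro y
      rw [add_comm, add_pow]
      refine Finset.sum_congr rfl fun j _ => ?_
      rw [mul_pow]; ring
    simp_rw [hexp]
    rw [integral_finsetSum]
    · refine Finset.sum_congr rfl fun j _ => ?_
      rw [integral_mul_const]; ring
    · intro j _
      refine Integrable.mul_const ?_ _
      simpa only [mul_comm] using hab (2 * (k + 1) - j) j
  have h2 := congrArg (fun q : ℝ[X] => q.coeff 2) hpoly
  simp only [finsetSum_coeff, coeff_C_mul, coeff_X_pow, coeff_mul_C] at h2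
  rw [Finset.sum_eq_single 2 (by intro j _ hj; simp [hj.symm]) (by simp)] at h2
  have he : (expand ℝ 2 ((1 + X : ℝ[X]) ^ (k + 1))).coeff 2 = k + 1 := by
    have := coeff_expand_mul (R := ℝ) (p := 2) (by norm_num) ((1 + X : ℝ[X]) ^ (k + 1)) 1
    rw [one_mul] at this
    rw [this, coeff_one_add_X_pow]; simp
  rw [he] at h2
  have hch : ((2 * (k + 1)).choose 2 : ℝ) = (k + 1) * (2 * k + 1) := by
    rw [Nat.cast_choose_two]; push_cast; ring
  rw [hch, if_pos rfl, mul_one, show 2 * (k + 1) - 2 = 2 * k by omega] at h2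
  have hk : (k + 1 : ℝ) ≠ 0 := by positivity
  refine mul_left_cancel₀ hk (Eq.trans ?_ h2)
  simp only [mul_comm (a _ ^ _)]
  ring

-- Let `y = Q x`. Multiply `y₀ ^ (2k)` by `|x|² = ∑ yᵢ²` and integrate. The term `i = 0` is the next
-- moment; each of the other `n` terms is that moment divided by `2k + 1`, by comparing coefficients
-- for the direction `e₀ + t eᵢ`, of squared length `1 + t²`.
open Matrix in
theorem firstCoordMoment_succ {n : ℕ} (x : Fin (n + 1) → ℝ) (k : ℕ) :
    ((n + 1 : ℝ) + 2 * k) * firstCoordMoment x (k + 1) =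
      (1 + 2 * k) * (x ⬝ᵥ x) * firstCoordMoment x k := by
  have hcont : ∀ i, Continuous fun Q : OrthGroup (n + 1) => (Q.1 *ᵥ x) i :=
    fun i => (continuous_apply i).comp (continuous_orth_mulVec x)
  have hoff : ∀ i : Fin (n + 1), i ≠ 0 → (2 * k + 1) * ∫ Q : OrthGroup (n + 1),
      (Q.1 *ᵥ x) 0 ^ (2 * k) * (Q.1 *ᵥ x) i ^ 2 ∂haarOrth (n + 1) =
        firstCoordMoment x (k + 1) := by
    intro i hi
    refine coeff_two_of_integral_add_mul_pow
      (fun j l => (((hcont 0).pow j).mul ((hcont i).pow l)).integrable_of_compactSpace) ?_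
    intro t
    have := integral_haarOrth_dotProduct_pow (Pi.single 0 1 + Pi.single i t) x (k + 1)
    simp only [add_dotProduct, single_dotProduct, one_mul, Pi.add_apply, Pi.single_eq_same,
      Pi.single_eq_of_ne hi, Pi.single_eq_of_ne hi.symm, add_zero, zero_add, ← sq, one_pow] at this
    exact this
  have hsum : (x ⬝ᵥ x) * firstCoordMoment x k = ∑ i, ∫ Q : OrthGroup (n + 1),
      (Q.1 *ᵥ x) 0 ^ (2 * k) * (Q.1 *ᵥ x) i ^ 2 ∂haarOrth (n + 1) := by
    rw [← integral_finsetSum, firstCoordMoment, ← integral_const_mul]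
    swap
    · exact fun i _ => (((hcont 0).pow (2 * k)).mul ((hcont i).pow 2)).integrable_of_compactSpace
    congr 1 with Q
    rw [← Finset.mul_sum, mul_comm, ← orth_mulVec_dotProduct_self Q x]
    simp only [dotProduct, sq]
  rw [Fin.sum_univ_succ] at hsum
  have h0 : ∫ Q : OrthGroup (n + 1),
      (Q.1 *ᵥ x) 0 ^ (2 * k) * (Q.1 *ᵥ x) 0 ^ 2 ∂haarOrth (n + 1) =
        firstCoordMoment x (k + 1) := by
    simp only [← pow_add, firstCoordMoment, mul_add, mul_one]
  have hs : (2 * k + 1 : ℝ) * ∑ i : Fin n, ∫ Q : OrthGroup (n + 1),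
      (Q.1 *ᵥ x) 0 ^ (2 * k) * (Q.1 *ᵥ x) i.succ ^ 2
        ∂haarOrth (n + 1) = n * firstCoordMoment x (k + 1) := by
    rw [Finset.mul_sum, Finset.sum_congr rfl fun i _ => hoff i.succ i.succ_ne_zero]
    simp
  rw [h0] at hsum
  linear_combination (-(2 * k + 1) : ℝ) * hsum - hs

/-! ### Rising factorials with step two: closed form of the moments, addition formula, size. -/

/-- The product `x (x + 2) ⋯ (x + 2 (k - 1))`. -/
noncomputable def risingTwo (x : ℝ) (k : ℕ) : ℝ := ∏ i ∈ Finset.range k, (x + 2 * i)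

theorem risingTwo_succ (x : ℝ) (k : ℕ) : risingTwo x (k + 1) = risingTwo x k * (x + 2 * k) :=
  Finset.prod_range_succ _ _

@[simp] theorem risingTwo_zero (x : ℝ) : risingTwo x 0 = 1 := rfl

theorem risingTwo_pos {x : ℝ} (hx : 0 < x) (k : ℕ) : 0 < risingTwo x k :=
  Finset.prod_pos fun i _ => by positivity

open Matrix in
theorem firstCoordMoment_eq {n : ℕ} (x : Fin (n + 1) → ℝ) (k : ℕ) :
    firstCoordMoment x k = (x ⬝ᵥ x) ^ k * risingTwo 1 k / risingTwo (n + 1) k := by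
  induction k with
  | zero => simp [firstCoordMoment]
  | succ k ih =>
    have h := firstCoordMoment_succ x k
    have h1 := (risingTwo_pos (show (0 : ℝ) < n + 1 by positivity) k).ne'
    have h2 : (n + 1 + 2 * k : ℝ) ≠ 0 := by positivity
    rw [ih] at h
    rw [risingTwo_succ, risingTwo_succ, eq_div_iff (mul_ne_zero h1 h2)]
    field_simp at h
    linear_combination h

open Matrix in
/-- The even moments of `⟨u, Q x⟩` for `Q` uniform on the orthogonal group. -/
theorem integral_haarOrth_dotProduct_pow_eq {n : ℕ} (hn : 0 < n) (u x : Fin n → ℝ) (k : ℕ) :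
    ∫ Q : OrthGroup n, (u ⬝ᵥ (Q.1 *ᵥ x)) ^ (2 * k) ∂haarOrth n =
      (u ⬝ᵥ u) ^ k * (x ⬝ᵥ x) ^ k * (risingTwo 1 k / risingTwo n k) := by
  obtain ⟨n, rfl⟩ := Nat.exists_eq_succ_of_ne_zero hn.ne'
  rw [integral_haarOrth_dotProduct_pow, firstCoordMoment_eq]
  push_cast
  ring

/-- Vandermonde's convolution with step two, reflecting that degrees of freedom add for independent
chi-square variables. The induction splits `x + y + 2k` as `(x + 2i) + (y + 2(k - i))` and uses
Pascal's rule. -/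
theorem risingTwo_add (x y : ℝ) (k : ℕ) :
    risingTwo (x + y) k =
      ∑ i ∈ Finset.range (k + 1), risingTwo x i * risingTwo y (k - i) * (k.choose i : ℝ) := by
  induction k with
  | zero => simp
  | succ k ih =>
    have key := Finset.sum_antidiagonal_choose_succ_mul
      (fun i j => risingTwo x i * risingTwo y j) k
    rw [Finset.Nat.sum_antidiagonal_eq_sum_range_succ_mk,
      Finset.Nat.sum_antidiagonal_eq_sum_range_succ_mk,
      Finset.Nat.sum_antidiagonal_eq_sum_range_succ_mk] at key
    simp only [mul_comm (_ * _ : ℝ) (Nat.cast _ : ℝ)] at ih ⊢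
    rw [key, risingTwo_succ, ih, Finset.sum_mul, ← Finset.sum_add_distrib]
    refine Finset.sum_congr rfl fun i hi => ?_
    have hik : i ≤ k := Nat.lt_succ_iff.mp (Finset.mem_range.mp hi)
    simp only [risingTwo_succ, Nat.cast_sub hik, Nat.choose_symm hik]
    ring

theorem pow_le_risingTwo {x : ℝ} (hx : 0 ≤ x) (k : ℕ) : x ^ k ≤ risingTwo x k := by
  rw [risingTwo, ← Finset.card_range k, ← Finset.prod_const, Finset.card_range]
  exact Finset.prod_le_prod (fun _ _ => hx) fun i _ => by
    have : (0 : ℝ) ≤ i := i.cast_nonneg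
    linarith

/-- Pair factor `i` with factor `k - 1 - i`: their mean is `x + k - 1`, so AM–GM bounds each product
by `(x + k) ^ 2`. -/
theorem risingTwo_le_pow {x : ℝ} (hx : 0 < x) (k : ℕ) : risingTwo x k ≤ (x + k) ^ k := by
  refine le_of_sq_le_sq ?_ (by positivity)
  have hrefl : risingTwo x k = ∏ i ∈ Finset.range k, (x + 2 * ((k - 1 - i : ℕ) : ℝ)) :=
    (Finset.prod_range_reflect (fun i => x + 2 * (i : ℝ)) k).symm
  calc risingTwo x k ^ 2
      = ∏ i ∈ Finset.range k, (x + 2 * i) * (x + 2 * ((k - 1 - i : ℕ) : ℝ)) := by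
        rw [Finset.prod_mul_distrib, ← hrefl, sq]; rfl
    _ ≤ ∏ _i ∈ Finset.range k, (x + k) ^ 2 := by
        refine Finset.prod_le_prod (fun i _ => by positivity) fun i hi => ?_
        have h : ((k - 1 - i : ℕ) : ℝ) + i + 1 = k := by
          have := Finset.mem_range.mp hi
          exact_mod_cast (by omega : k - 1 - i + i + 1 = k)
        have hi0 : (0 : ℝ) ≤ i := i.cast_nonneg
        have hj0 : (0 : ℝ) ≤ ((k - 1 - i : ℕ) : ℝ) := Nat.cast_nonneg _
        rw [← h]
        nlinarith [sq_nonneg ((i : ℝ) - ((k - 1 - i : ℕ) : ℝ))]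
    _ = ((x + k) ^ k) ^ 2 := by simp [← pow_mul, mul_comm]

/-- `1 · 3 · 5 ⋯` dominates `k!` factor by factor, and `k ^ k / k!` is one term of the series of
`exp k`. -/
theorem pow_le_exp_pow_mul_risingTwo_one (k : ℕ) :
    (k : ℝ) ^ k ≤ Real.exp 1 ^ k * risingTwo 1 k := by
  have h1 : (k.factorial : ℝ) ≤ risingTwo 1 k := by
    rw [← Finset.prod_range_add_one_eq_factorial, Nat.cast_prod]
    refine Finset.prod_le_prod (fun i _ => by positivity) fun i _ => ?_
    have hi0 : (0 : ℝ) ≤ i := i.cast_nonneg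
    push_cast; linarith
  have h2 := Real.pow_div_factorial_le_exp (k : ℝ) k.cast_nonneg k
  rw [div_le_iff₀ (by positivity)] at h2
  rw [← Real.exp_nat_mul, mul_one]
  exact h2.trans (mul_le_mul_of_nonneg_left h1 (Real.exp_pos _).le)

/-- The numerical estimate behind the bound on the operator norm. -/
theorem risingTwo_mul_risingTwo_le {x y : ℝ} (hx : 1 ≤ x) (hy : 1 ≤ y) :
    risingTwo x ⌈√(x * y)⌉₊ * risingTwo y ⌈√(x * y)⌉₊ ≤
      (9 / 10) ^ ⌈√(x * y)⌉₊ * (risingTwo 1 ⌈√(x * y)⌉₊ * (4 * (√x + √y) ^ 2) ^ ⌈√(x * y)⌉₊) := by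
  set k := ⌈√(x * y)⌉₊ with hk
  have hr1 : 1 ≤ √(x * y) := Real.one_le_sqrt.mpr (one_le_mul_of_one_le_of_one_le hx hy)
  have hkr : √(x * y) ≤ k := Nat.le_ceil _
  have hkr' : (k : ℝ) ≤ √(x * y) + 1 := (Nat.ceil_lt_add_one (by positivity)).le
  have hk0 : (0 : ℝ) < k := by linarith
  have hxy : x * y = √(x * y) ^ 2 := (Real.sq_sqrt (by positivity)).symm
  have hS : (√x + √y) ^ 2 = x + y + 2 * √(x * y) := by
    rw [add_sq, Real.sq_sqrt (by linarith), Real.sq_sqrt (by linarith), Real.sqrt_mul (by linarith)]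
    ring
  have he : Real.exp 1 ≤ 2.72 := (Real.exp_one_lt_d9.trans (by norm_num)).le
  have hbase : (x + k) * (y + k) * Real.exp 1 ≤ 9 / 10 * (4 * (√x + √y) ^ 2) * k := by
    -- The choice `k ≈ √(xy)` balances `xy / k` against `k`; rounding up costs the `+ 1`.
    have h1 : (x + k) * (y + k) ≤ (x + y + 2 * √(x * y) + 1) * k := by nlinarith
    -- Since `x + y + 2√(xy) ≥ 4`, the slack `3.6 - 2.72` per unit absorbs the extra `2.72`.
    have h2 : (x + y + 2 * √(x * y) + 1) * 2.72 ≤ 9 / 10 * (4 * (x + y + 2 * √(x * y))) := by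
      linarith
    calc (x + k) * (y + k) * Real.exp 1 ≤ (x + y + 2 * √(x * y) + 1) * k * 2.72 := by gcongr
      _ = (x + y + 2 * √(x * y) + 1) * 2.72 * k := by ring
      _ ≤ _ := by rw [hS]; gcongr
  have hpow := pow_le_pow_left₀ (by positivity) hbase k
  have hF := pow_le_exp_pow_mul_risingTwo_one k
  have hkk : (0 : ℝ) < (k : ℝ) ^ k := by positivity
  have hek : (0 : ℝ) < Real.exp 1 ^ k := by positivity
  have h3 : risingTwo x k * risingTwo y k ≤ (x + k) ^ k * (y + k) ^ k :=
    mul_le_mul (risingTwo_le_pow (by linarith) k) (risingTwo_le_pow (by linarith) k)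
      (risingTwo_pos (by linarith) k).le (by positivity)
  refine h3.trans ?_
  refine le_of_mul_le_mul_right ?_ hek
  calc (x + k) ^ k * (y + k) ^ k * Real.exp 1 ^ k = ((x + k) * (y + k) * Real.exp 1) ^ k := by
        rw [mul_pow, mul_pow]
    _ ≤ (9 / 10 * (4 * (√x + √y) ^ 2) * k) ^ k := hpow
    _ = (9 / 10) ^ k * (4 * (√x + √y) ^ 2) ^ k * (k : ℝ) ^ k := by rw [mul_pow, mul_pow]
    _ ≤ (9 / 10) ^ k * (4 * (√x + √y) ^ 2) ^ k * (Real.exp 1 ^ k * risingTwo 1 k) := by gcongr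
    _ = _ := by ring

/-! ### Moments of sums of independent nonnegative variables -/

/-- Adding one variable at a time, the binomial expansion factors by independence, and
`risingTwo_add` reassembles the bounds. The uniform bound `C` makes all the products integrable. -/
theorem integral_sum_pow_le_risingTwo {ι Y : Type*} [MeasurableSpace Y] {μ : Measure Y}
    [IsProbabilityMeasure μ] {Z : ι → Y → ℝ} (hind : iIndepFun Z μ)
    (hm : ∀ i, Measurable (Z i)) {C : ℝ} (h0 : ∀ i y, 0 ≤ Z i y) (hC : ∀ i y, Z i y ≤ C)
    {a : ℝ} (hmom : ∀ i k, ∫ y, Z i y ^ k ∂μ ≤ a ^ k * risingTwo 1 k)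
    (s : Finset ι) (k : ℕ) :
    ∫ y, (∑ i ∈ s, Z i y) ^ k ∂μ ≤ a ^ k * risingTwo s.card k := by
  classical
  induction s using Finset.induction_on generalizing k with
  | empty =>
    rcases k with _ | k
    · simp
    · simp [risingTwo, Finset.prod_range_succ']
  | insert j s hj ih =>
    have hindep : IndepFun (fun y => ∑ i ∈ s, Z i y) (Z j) μ := by
      simpa only [Finset.sum_fn] using hind.indepFun_finsetSum_of_notMem hm hj
    have hsm : Measurable fun y => ∑ i ∈ s, Z i y := Finset.measurable_sum _ fun i _ => hm i
    have hs0 : ∀ y, 0 ≤ ∑ i ∈ s, Z i y := fun y => Finset.sum_nonneg fun i _ => h0 i y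
    have hsC : ∀ y, ∑ i ∈ s, Z i y ≤ s.card * C := fun y => by
      simpa using Finset.sum_le_card_nsmul s (fun i => Z i y) C fun i _ => hC i y
    have hint : ∀ l r, Integrable (fun y => (∑ i ∈ s, Z i y) ^ l * Z j y ^ r) μ := by
      intro l r
      refine Integrable.of_bound ((hsm.pow_const l).mul ((hm j).pow_const r)).aestronglyMeasurable
        ((s.card * C) ^ l * C ^ r) (ae_of_all _ fun y => ?_)
      have h1 := pow_le_pow_left₀ (hs0 y) (hsC y) l
      have h2 := pow_le_pow_left₀ (h0 j y) (hC j y) r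
      have h3 := pow_nonneg (hs0 y) l
      have h4 := pow_nonneg (h0 j y) r
      rw [Real.norm_of_nonneg (mul_nonneg h3 h4)]
      exact mul_le_mul h1 h2 h4 (h3.trans h1)
    have hprod : ∀ l r, ∫ y, (∑ i ∈ s, Z i y) ^ l * Z j y ^ r ∂μ ≤
        a ^ l * risingTwo s.card l * (a ^ r * risingTwo 1 r) := by
      intro l r
      have h := (hindep.comp (measurable_id.pow_const l)
        (measurable_id.pow_const r)).integral_fun_mul_eq_mul_integral
        (hsm.pow_const l).aestronglyMeasurable ((hm j).pow_const r).aestronglyMeasurable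
      simp only [Function.comp_apply, id_eq] at h
      rw [h]
      refine mul_le_mul (ih l) (hmom j r)
        (integral_nonneg fun y => pow_nonneg (h0 j y) r) ?_
      exact (integral_nonneg fun y => pow_nonneg (hs0 y) l).trans (ih l)
    have hexp : ∀ y, (∑ i ∈ insert j s, Z i y) ^ k = ∑ l ∈ Finset.range (k + 1),
        ((∑ i ∈ s, Z i y) ^ l * Z j y ^ (k - l)) * (k.choose l : ℝ) := by
      intro y
      rw [Finset.sum_insert hj, add_comm, add_pow]
    simp_rw [hexp]
    rw [integral_finsetSum _ fun l _ => (hint l (k - l)).mul_const _, Finset.card_insert_of_notMem hj,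
      Nat.cast_add, Nat.cast_one, risingTwo_add, Finset.mul_sum]
    refine Finset.sum_le_sum fun l hl => ?_
    have hlk : l + (k - l) = k := by have := Finset.mem_range.mp hl; omega
    rw [integral_mul_const, ← mul_assoc]
    refine mul_le_mul_of_nonneg_right ((hprod l (k - l)).trans (le_of_eq ?_)) (Nat.cast_nonneg _)
    rw [← hlk, pow_add, hlk]; ring

/-! ### The operator norm of a matrix with uniformly rotated columns -/

open Matrix in
theorem maxColNorm_nonneg {n p : ℕ} (X : Matrix (Fin n) (Fin p) ℝ) : 0 ≤ maxColNorm X :=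
  Real.iSup_nonneg fun _ => norm_nonneg _

open Matrix in
theorem col_dotProduct_self_le {n p : ℕ} {X : Matrix (Fin n) (Fin p) ℝ} {M : ℝ}
    (h : maxColNorm X ≤ M) (j : Fin p) : (fun i => X i j) ⬝ᵥ (fun i => X i j) ≤ M ^ 2 := by
  have h1 : ‖WithLp.toLp 2 fun i : Fin n => X i j‖ ≤ M :=
    (le_ciSup (f := fun j => ‖WithLp.toLp 2 fun i : Fin n => X i j‖)
      (Set.finite_range _).bddAbove j).trans h
  have h2 := pow_le_pow_left₀ (norm_nonneg _) h1 2
  rw [EuclideanSpace.norm_sq_eq] at h2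
  simpa [dotProduct, sq] using h2

open Matrix in
theorem exists_lt_of_lt_matOpNorm {n p : ℕ} {W : Matrix (Fin n) (Fin p) ℝ} {B : ℝ} (hB : 0 ≤ B)
    (h : B < matOpNorm W) : ∃ a : Fin p → ℝ, B ^ 2 * (a ⬝ᵥ a) < (W *ᵥ a) ⬝ᵥ (W *ᵥ a) := by
  by_contra! hcon
  refine absurd h (not_lt.mpr ?_)
  rw [matOpNorm, Matrix.l2_opNorm_def]
  refine ContinuousLinearMap.opNorm_le_bound _ hB fun x => ?_
  refine le_of_sq_le_sq ?_ (by positivity)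
  rw [mul_pow, EuclideanSpace.norm_sq_eq, EuclideanSpace.norm_sq_eq]
  simpa [dotProduct, sq] using hcon x.ofLp

open Matrix in
theorem continuous_rotateColumns {n p : ℕ} (X : Matrix (Fin n) (Fin p) ℝ) :
    Continuous fun g : Fin p → OrthGroup n => rotateColumns g X := by
  refine continuous_matrix fun i j => ?_
  exact (continuous_apply i).comp ((continuous_orth_mulVec fun l => X l j).comp (continuous_apply j))

instance haarColumnsIsProbabilityMeasure (n p : ℕ) : IsProbabilityMeasure (haarColumns n p) := by
  unfold haarColumns; infer_instance

-- `|uᵀW|²` is the sum of the independent variables `⟨u, Q_j x_j⟩²`. Their exact moments carry the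
-- denominator `risingTwo n k ≥ n ^ k`, which gives the scale `M² / n`.
open Matrix in
theorem integral_vecMul_rotateColumns_pow_le {n p : ℕ} (hn : 0 < n)
    {X : Matrix (Fin n) (Fin p) ℝ} {M : ℝ} (hX : maxColNorm X ≤ M) (u : Fin n → ℝ)
    (hu : u ⬝ᵥ u = 1) (k : ℕ) :
    ∫ g, ((u ᵥ* rotateColumns g X) ⬝ᵥ (u ᵥ* rotateColumns g X)) ^ k ∂haarColumns n p ≤
      (M ^ 2 / n) ^ k * risingTwo p k := by
  let Z : Fin p → OrthGroup n → ℝ := fun j Q => (u ⬝ᵥ (Q.1 *ᵥ fun l => X l j)) ^ 2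
  have hZc : ∀ j, Continuous (Z j) := fun j => by
    have := continuous_orth_mulVec fun l => X l j
    fun_prop
  have hn' : (0 : ℝ) < n := by exact_mod_cast hn
  have hind : iIndepFun (fun j (g : Fin p → OrthGroup n) => Z j (g j)) (haarColumns n p) :=
    iIndepFun_pi fun j => (hZc j).measurable.aemeasurable
  have hbound : ∀ j Q, Z j Q ≤ M ^ 2 := by
    intro j Q
    have h : Z j Q ≤ (u ⬝ᵥ u) * ((Q.1 *ᵥ fun l => X l j) ⬝ᵥ (Q.1 *ᵥ fun l => X l j)) := by
      simpa [Z, dotProduct, sq] using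
        Finset.sum_mul_sq_le_sq_mul_sq Finset.univ u (Q.1 *ᵥ fun l => X l j)
    rw [hu, orth_mulVec_dotProduct_self, one_mul] at h
    exact h.trans (col_dotProduct_self_le hX j)
  have hmom : ∀ j k, ∫ g : Fin p → OrthGroup n, Z j (g j) ^ k ∂haarColumns n p ≤
      (M ^ 2 / n) ^ k * risingTwo 1 k := by
    intro j k
    have h1 : ∫ g : Fin p → OrthGroup n, Z j (g j) ^ k ∂haarColumns n p =
        ∫ Q, Z j Q ^ k ∂haarOrth n :=
      integral_comp_eval (μ := fun _ : Fin p => haarOrth n) (i := j) (f := fun Q => Z j Q ^ k)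
        ((hZc j).pow k).aestronglyMeasurable
    simp only [Z, ← pow_mul] at h1 ⊢
    rw [h1, integral_haarOrth_dotProduct_pow_eq hn, hu, one_pow, one_mul, div_pow,
      mul_div_assoc', div_mul_eq_mul_div]
    refine div_le_div₀ ?_ ?_ (by positivity) (pow_le_risingTwo hn'.le k)
    · exact mul_nonneg (by positivity) (risingTwo_pos one_pos k).le
    · refine mul_le_mul_of_nonneg_right ?_ (risingTwo_pos one_pos k).le
      exact pow_le_pow_left₀ (Finset.sum_nonneg fun i _ => mul_self_nonneg _)
        (col_dotProduct_self_le hX j) k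
  have := integral_sum_pow_le_risingTwo hind
    (fun j => (hZc j).measurable.comp (measurable_pi_apply j)) (fun j g => sq_nonneg _)
    (fun j g => hbound j (g j)) hmom Finset.univ k
  simp only [Finset.card_univ, Fintype.card_fin] at this
  refine le_trans (le_of_eq ?_) this
  congr 1 with g
  congr 1
  exact Finset.sum_congr rfl fun j _ => (sq _).symm

-- Choose `a` with `|W a| > B |a|`. Cauchy–Schwarz gives `⟨W a, Q e⟩² ≤ |a|² |(Q e)ᵀ W|²`, and the
-- `k`-th power of the left side has an explicit average over `Q`. The direction `a` may depend on
-- `W`, as the resulting bound does not involve it.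
open Matrix in
theorem pow_mul_le_integral_of_lt_matOpNorm {n p : ℕ} (hn : 0 < n) {W : Matrix (Fin n) (Fin p) ℝ}
    {B : ℝ} (hB : 0 ≤ B) (h : B < matOpNorm W) (e : Fin n → ℝ) (he : e ⬝ᵥ e = 1) (k : ℕ) :
    (B ^ 2) ^ k * (risingTwo 1 k / risingTwo n k) ≤
      ∫ Q : OrthGroup n, (((Q.1 *ᵥ e) ᵥ* W) ⬝ᵥ ((Q.1 *ᵥ e) ᵥ* W)) ^ k ∂haarOrth n := by
  obtain ⟨a, ha⟩ := exists_lt_of_lt_matOpNorm hB h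
  have hn' : (0 : ℝ) < n := by exact_mod_cast hn
  have ha0 : 0 ≤ a ⬝ᵥ a := Finset.sum_nonneg fun i _ => mul_self_nonneg (a i)
  have hapos : 0 < a ⬝ᵥ a := by
    refine lt_of_le_of_ne ha0 fun h0 => ?_
    rw [dotProduct_self_eq_zero.mp h0.symm] at ha
    simp at ha
  have hr : 0 ≤ risingTwo 1 k / risingTwo n k :=
    (div_pos (risingTwo_pos one_pos k) (risingTwo_pos hn' k)).le
  have hQ := continuous_orth_mulVec e
  have key : ((W *ᵥ a) ⬝ᵥ (W *ᵥ a)) ^ k * (risingTwo 1 k / risingTwo n k) ≤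
      (a ⬝ᵥ a) ^ k *
        ∫ Q : OrthGroup n, (((Q.1 *ᵥ e) ᵥ* W) ⬝ᵥ ((Q.1 *ᵥ e) ᵥ* W)) ^ k ∂haarOrth n := by
    have h1 := integral_haarOrth_dotProduct_pow_eq hn (W *ᵥ a) e k
    rw [he, one_pow, mul_one] at h1
    rw [← h1, ← integral_const_mul]
    refine integral_mono (Continuous.integrable_of_compactSpace (by fun_prop))
      (Continuous.integrable_of_compactSpace (by fun_prop)) fun Q => ?_
    simp only [pow_mul, ← mul_pow]
    refine pow_le_pow_left₀ (sq_nonneg _) ?_ k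
    rw [dotProduct_comm, dotProduct_mulVec, dotProduct_comm]
    simpa [dotProduct, sq] using
      Finset.sum_mul_sq_le_sq_mul_sq Finset.univ a ((Q.1 *ᵥ e) ᵥ* W)
  have h2 : (B ^ 2 * (a ⬝ᵥ a)) ^ k * (risingTwo 1 k / risingTwo n k) ≤
      ((W *ᵥ a) ⬝ᵥ (W *ᵥ a)) ^ k * (risingTwo 1 k / risingTwo n k) :=
    mul_le_mul_of_nonneg_right (pow_le_pow_left₀ (by positivity) ha.le k) hr
  refine le_of_mul_le_mul_left ?_ (pow_pos hapos k)
  calc _ = (B ^ 2 * (a ⬝ᵥ a)) ^ k * (risingTwo 1 k / risingTwo n k) := by rw [mul_pow]; ring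
    _ ≤ _ := h2.trans key

open Matrix in
/-- A moment bound for the upper tail of the operator norm of a matrix with independent uniformly
rotated columns. -/
theorem haarColumns_real_lt_matOpNorm_mul_le {n p : ℕ} (hn : 0 < n)
    {X : Matrix (Fin n) (Fin p) ℝ} {M B : ℝ} (hX : maxColNorm X ≤ M) (hB : 0 ≤ B) (k : ℕ) :
    ((B ^ 2) ^ k * (risingTwo 1 k / risingTwo n k)) *
      (haarColumns n p).real {g | B < matOpNorm (rotateColumns g X)} ≤
        (M ^ 2 / n) ^ k * risingTwo p k := by
  obtain ⟨e, he⟩ : ∃ e : Fin n → ℝ, e ⬝ᵥ e = 1 := ⟨Pi.single ⟨0, hn⟩ 1, by simp⟩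
  let H : (Fin p → OrthGroup n) → OrthGroup n → ℝ := fun g Q =>
    (((Q.1 *ᵥ e) ᵥ* rotateColumns g X) ⬝ᵥ ((Q.1 *ᵥ e) ᵥ* rotateColumns g X)) ^ k
  have hH0 : ∀ g Q, 0 ≤ H g Q := fun g Q =>
    pow_nonneg (Finset.sum_nonneg fun i _ => mul_self_nonneg _) k
  have hHc : Continuous (Function.uncurry H) := by
    have h1 := (continuous_orth_mulVec e).comp
      (continuous_snd : Continuous (Prod.snd : (Fin p → OrthGroup n) × OrthGroup n → _))
    have h2 := (continuous_rotateColumns X).comp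
      (continuous_fst : Continuous (Prod.fst : (Fin p → OrthGroup n) × OrthGroup n → _))
    have h3 := h1.matrix_vecMul h2
    exact (h3.dotProduct h3).pow k
  have hHint : Integrable (Function.uncurry H) ((haarColumns n p).prod (haarOrth n)) :=
    hHc.integrable_of_compactSpace
  have hint : Integrable (fun g => ∫ Q, H g Q ∂haarOrth n) (haarColumns n p) :=
    hHint.integral_prod_left
  have hc : 0 ≤ (B ^ 2) ^ k * (risingTwo 1 k / risingTwo n k) :=
    mul_nonneg (by positivity) (div_pos (risingTwo_pos one_pos k)
      (risingTwo_pos (by exact_mod_cast hn) k)).le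
  -- Markov's inequality is applied in `g` to the average over `Q`. After swapping the integrals, `Q
  -- e` is a fixed unit vector and the moment bound for column rotations applies.
  have hmarkov := mul_meas_ge_le_integral_of_nonneg
    (ae_of_all _ fun g => integral_nonneg fun Q => hH0 g Q) hint
    ((B ^ 2) ^ k * (risingTwo 1 k / risingTwo n k))
  refine (mul_le_mul_of_nonneg_left ?_ hc).trans (hmarkov.trans ?_)
  · refine measureReal_mono fun g hg => ?_
    exact pow_mul_le_integral_of_lt_matOpNorm hn hB hg e he k
  · rw [integral_integral_swap hHint]
    have hle : ∀ Q : OrthGroup n, ∫ g, H g Q ∂haarColumns n p ≤ (M ^ 2 / n) ^ k * risingTwo p k :=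
      fun Q => integral_vecMul_rotateColumns_pow_le hn hX _
        (by rw [orth_mulVec_dotProduct_self, he]) k
    calc _ ≤ ∫ _Q : OrthGroup n, (M ^ 2 / n) ^ k * risingTwo p k ∂haarOrth n :=
          integral_mono hHint.integral_prod_right (integrable_const _) hle
      _ = _ := by simp

open Matrix in
/-- A matrix with independent columns, uniformly distributed on spheres of radii at most `M`, has
operator norm at most `2 M (√n + √p) / √n` up to an exponentially small probability. -/
theorem haarColumns_lt_matOpNorm_le {n p : ℕ} (hn : 0 < n) (hp : 0 < p)
    {X : Matrix (Fin n) (Fin p) ℝ} {M : ℝ} (hX : maxColNorm X ≤ M) :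
    haarColumns n p {g | 2 * M * ((√n + √p) / √n) < matOpNorm (rotateColumns g X)} ≤
      ENNReal.ofReal ((9 / 10) ^ ⌈√((n : ℝ) * p)⌉₊) := by
  have hM0 : 0 ≤ M := (maxColNorm_nonneg X).trans hX
  have hn' : (0 : ℝ) < n := by exact_mod_cast hn
  have hp' : (0 : ℝ) < p := by exact_mod_cast hp
  -- The main case cancels a power of `M`; for `M = 0` the matrix vanishes.
  rcases hM0.eq_or_lt with rfl | hM
  · have hX0 : X = 0 := by
      ext i j
      have h := col_dotProduct_self_le hX j
      rw [sq, zero_mul] at h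
      have h' := le_antisymm h (Finset.sum_nonneg fun i _ => mul_self_nonneg (X i j))
      exact congrFun (dotProduct_self_eq_zero.mp h') i
    have hrot : ∀ g : Fin p → OrthGroup n, matOpNorm (rotateColumns g X) = 0 := by
      intro g
      have : rotateColumns g X = 0 := by
        ext i j
        simp [rotateColumns, hX0, mulVec, dotProduct]
      rw [this, matOpNorm]
      simp [Matrix.l2_opNorm_def]
    simp [hrot]
  · set k := ⌈√((n : ℝ) * p)⌉₊ with hk
    set B : ℝ := 2 * M * ((√n + √p) / √n) with hB
    have hB0 : 0 < B := by positivity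
    have hFn := risingTwo_pos hn' k
    have hF1 := risingTwo_pos one_pos k
    have h1 := haarColumns_real_lt_matOpNorm_mul_le hn hX hB0.le k
    have h2 := risingTwo_mul_risingTwo_le (x := n) (y := p) (by exact_mod_cast hn)
      (by exact_mod_cast hp)
    rw [← hk] at h2
    -- The factor `(M² / n) ^ k` now cancels from the moment bound, leaving exactly
    -- `risingTwo_mul_risingTwo_le`.
    have hBsq : B ^ 2 = M ^ 2 / n * (4 * (√n + √p) ^ 2) := by
      rw [hB, mul_pow, div_pow, Real.sq_sqrt hn'.le]; ring
    rw [← ofReal_measureReal]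
    refine ENNReal.ofReal_le_ofReal ?_
    set μ := (haarColumns n p).real {g | B < matOpNorm (rotateColumns g X)}
    have hpos : 0 < (M ^ 2 / n) ^ k * (4 * (√n + √p) ^ 2) ^ k *
        (risingTwo 1 k / risingTwo n k) := by positivity
    rw [hBsq, mul_pow] at h1
    refine le_of_mul_le_mul_left (h1.trans ?_) hpos
    rw [mul_assoc, mul_assoc]
    refine mul_le_mul_of_nonneg_left ?_ (by positivity)
    rw [div_mul_eq_mul_div, mul_div_assoc', le_div_iff₀ hFn]
    linarith

/-! ### Measurability -/

open scoped Matrix.Norms.L2Operator in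
theorem continuous_matOpNorm {n p : ℕ} :
    Continuous (matOpNorm : Matrix (Fin n) (Fin p) ℝ → ℝ) :=
  continuous_norm

open scoped Matrix.Norms.L2Operator in
theorem matOpNorm_sub_le_matOpNorm_add {n p : ℕ} (X Y : Matrix (Fin n) (Fin p) ℝ) :
    matOpNorm X - matOpNorm Y ≤ matOpNorm (X + Y) := by
  have := norm_sub_le (X + Y) Y
  rw [add_sub_cancel_right] at this
  exact sub_le_iff_le_add.mpr this

theorem measurable_matOpNorm_comp {Y : Type*} [MeasurableSpace Y] {n p : ℕ}
    {f : Y → Matrix (Fin n) (Fin p) ℝ} (hf : ∀ i j, Measurable fun y => f y i j) :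
    Measurable fun y => matOpNorm (f y) := by
  have h1 : Continuous fun x : Fin n → Fin p → ℝ => matOpNorm (Matrix.of x) :=
    continuous_matOpNorm.comp continuous_id
  have h2 : Measurable fun y => (fun i j => f y i j : Fin n → Fin p → ℝ) :=
    measurable_pi_lambda _ fun i => measurable_pi_lambda _ fun j => hf i j
  exact h1.measurable.comp h2

theorem measurable_maxColNorm_comp {Y : Type*} [MeasurableSpace Y] {n p : ℕ}
    {f : Y → Matrix (Fin n) (Fin p) ℝ} (hf : ∀ i j, Measurable fun y => f y i j) :
    Measurable fun y => maxColNorm (f y) := by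
  refine Measurable.iSup fun j => ?_
  simp only [EuclideanSpace.norm_eq]
  exact (Finset.measurable_sum _ fun i _ => (hf i j).norm.pow_const 2).sqrt

theorem measurable_rotateColumns_comp {Y : Type*} [MeasurableSpace Y] {n p : ℕ}
    {f : Y → Matrix (Fin n) (Fin p) ℝ} (hf : ∀ i j, Measurable fun y => f y i j)
    {g : Y → Fin p → OrthGroup n} (hg : Measurable g) (i : Fin n) (j : Fin p) :
    Measurable fun y => rotateColumns (g y) (f y) i j := by
  simp only [rotateColumns, Matrix.of_apply, Matrix.mulVec, dotProduct]
  refine Finset.measurable_sum _ fun l _ => Measurable.mul ?_ (hf l j)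
  have hc : Continuous fun Q : OrthGroup n => Q.1 i l :=
    continuous_subtype_val.matrix_elem i l
  exact hc.measurable.comp ((measurable_pi_apply j).comp hg)

/-! ### Column norms -/

open Matrix in
theorem norm_toLp_eq_sqrt_dotProduct {n : ℕ} (x : Fin n → ℝ) :
    ‖WithLp.toLp 2 x‖ = √(x ⬝ᵥ x) := by
  simp [EuclideanSpace.norm_eq, dotProduct, sq]

theorem maxColNorm_rotateColumns {n p : ℕ} (g : Fin p → OrthGroup n)
    (X : Matrix (Fin n) (Fin p) ℝ) : maxColNorm (rotateColumns g X) = maxColNorm X := by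
  refine iSup_congr fun j => ?_
  rw [norm_toLp_eq_sqrt_dotProduct, norm_toLp_eq_sqrt_dotProduct]
  exact congrArg Real.sqrt (orth_mulVec_dotProduct_self (g j) fun l => X l j)

theorem maxColNorm_add_le {n p : ℕ} (X Y : Matrix (Fin n) (Fin p) ℝ) :
    maxColNorm (X + Y) ≤ maxColNorm X + maxColNorm Y := by
  refine Real.iSup_le (fun j => ?_) (add_nonneg (maxColNorm_nonneg X) (maxColNorm_nonneg Y))
  have h : ∀ Z : Matrix (Fin n) (Fin p) ℝ, ‖WithLp.toLp 2 fun i => Z i j‖ ≤ maxColNorm Z :=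
    fun Z => le_ciSup (f := fun j => ‖WithLp.toLp 2 fun i : Fin n => Z i j‖)
      (Set.finite_range _).bddAbove j
  exact (norm_add_le (WithLp.toLp 2 fun i => X i j) (WithLp.toLp 2 fun i => Y i j)).trans
    (add_le_add (h X) (h Y))

/-! ### Spherical noise -/

open Matrix in
/-- The law of a matrix with independent spherical columns is invariant under column rotations. -/
theorem HasIndepSphericalColumns.measure_rotateColumns {Y : Type*} [MeasurableSpace Y]
    {P : Measure Y} [IsProbabilityMeasure P] {n p : ℕ} {N : Y → Matrix (Fin n) (Fin p) ℝ}
    (hN : ∀ i j, Measurable fun ω => N ω i j) (h : HasIndepSphericalColumns N P)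
    (g : Fin p → OrthGroup n) {A : Set (Fin p → Fin n → ℝ)} (hA : MeasurableSet A) :
    P {ω | (rotateColumns g (N ω))ᵀ ∈ A} = P {ω | (N ω)ᵀ ∈ A} := by
  have hcol : ∀ j, Measurable fun ω (i : Fin n) => N ω i j :=
    fun j => measurable_pi_lambda _ fun i => hN i j
  have hcols : Measurable fun ω (j : Fin p) (i : Fin n) => N ω i j :=
    measurable_pi_lambda _ hcol
  have hrot : ∀ j, Measurable fun v : Fin n → ℝ => (g j).1 *ᵥ v := fun j => by
    have : Continuous fun v : Fin n → ℝ => (g j).1 *ᵥ v := by fun_prop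
    exact this.measurable
  have hrots : Measurable fun (c : Fin p → Fin n → ℝ) (j : Fin p) => (g j).1 *ᵥ c j :=
    measurable_pi_lambda _ fun j => (hrot j).comp (measurable_pi_apply j)
  have hlaw := (iIndepFun_iff_map_fun_eq_pi_map fun j => (hcol j).aemeasurable).mp h.1
  have hprob : ∀ j, IsProbabilityMeasure (P.map fun ω (i : Fin n) => N ω i j) :=
    fun j => Measure.isProbabilityMeasure_map (hcol j).aemeasurable
  have hinv : (P.map fun ω (j : Fin p) (i : Fin n) => N ω i j).map
      (fun c j => (g j).1 *ᵥ c j) = P.map fun ω (j : Fin p) (i : Fin n) => N ω i j := by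
    have hprob' : ∀ j, IsProbabilityMeasure
        ((P.map fun ω (i : Fin n) => N ω i j).map fun v => (g j).1 *ᵥ v) :=
      fun j => Measure.isProbabilityMeasure_map (hrot j).aemeasurable
    rw [hlaw, Measure.pi_map_pi fun j => (hrot j).aemeasurable]
    congr 1 with j : 1
    exact h.2 j _ (g j).2
  have h1 := congrArg (fun ν => ν A) hinv
  simp only [Measure.map_apply hrots hA, Measure.map_apply hcols (hrots hA),
    Measure.map_apply hcols hA] at h1
  exact h1

/-- The operator norm of a matrix with independent spherical columns is at most
`2 t (√n + √p) / √n` on the event that its columns have norms at most `t`, up to an exponentially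
small probability. -/
theorem HasIndepSphericalColumns.measure_lt_matOpNorm_le {Y : Type*} [MeasurableSpace Y]
    {P : Measure Y} [IsProbabilityMeasure P] {n p : ℕ} (hn : 0 < n) (hp : 0 < p)
    {N : Y → Matrix (Fin n) (Fin p) ℝ} (hN : ∀ i j, Measurable fun ω => N ω i j)
    (h : HasIndepSphericalColumns N P) (t : ℝ) :
    P {ω | maxColNorm (N ω) ≤ t ∧ 2 * t * ((√n + √p) / √n) < matOpNorm (N ω)} ≤
      ENNReal.ofReal ((9 / 10) ^ ⌈√((n : ℝ) * p)⌉₊) := by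
  let A : Set (Fin p → Fin n → ℝ) := {c | maxColNorm (Matrix.of c).transpose ≤ t ∧
    2 * t * ((√n + √p) / √n) < matOpNorm (Matrix.of c).transpose}
  have hentry : ∀ i j, Measurable fun c : Fin p → Fin n → ℝ => (Matrix.of c).transpose i j :=
    fun i j => (measurable_pi_apply i).comp (measurable_pi_apply j)
  have hA : MeasurableSet A :=
    (measurableSet_le (measurable_maxColNorm_comp hentry) measurable_const).inter
      (measurableSet_lt measurable_const (measurable_matOpNorm_comp hentry))
  let S : Set (Y × (Fin p → OrthGroup n)) := {z | (rotateColumns z.2 (N z.1)).transpose ∈ A}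
  have hS : MeasurableSet S := by
    refine hA.preimage (f := fun z : Y × (Fin p → OrthGroup n) =>
      (fun j i => rotateColumns z.2 (N z.1) i j : Fin p → Fin n → ℝ)) ?_
    exact measurable_pi_lambda _ fun j => measurable_pi_lambda _ fun i =>
      measurable_rotateColumns_comp (fun i j => (hN i j).comp measurable_fst) measurable_snd i j
  -- Fubini in both orders: for fixed `g` rotation does not change the law of the noise, while for
  -- fixed `ω` the bound for Haar rotations applies.
  have h1 : P.prod (haarColumns n p) S = P {ω | (N ω).transpose ∈ A} := by
    rw [Measure.prod_apply_symm hS]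
    calc _ = ∫⁻ _g : Fin p → OrthGroup n, P {ω | (N ω).transpose ∈ A} ∂haarColumns n p :=
          lintegral_congr fun g => h.measure_rotateColumns hN g hA
      _ = _ := by simp
  have h2 : P.prod (haarColumns n p) S ≤ ENNReal.ofReal ((9 / 10) ^ ⌈√((n : ℝ) * p)⌉₊) := by
    rw [Measure.prod_apply hS]
    calc _ ≤ ∫⁻ _ω, ENNReal.ofReal ((9 / 10) ^ ⌈√((n : ℝ) * p)⌉₊) ∂P := by
          refine lintegral_mono fun ω => ?_
          by_cases hω : maxColNorm (N ω) ≤ t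
          · exact (measure_mono fun g hg => hg.2).trans (haarColumns_lt_matOpNorm_le hn hp hω)
          · have : Prod.mk ω ⁻¹' S = ∅ := by
              refine Set.eq_empty_of_forall_notMem fun g hg => hω ?_
              rw [← maxColNorm_rotateColumns g (N ω)]
              exact hg.1
            rw [this, measure_empty]
            exact zero_le
      _ = _ := by simp
  exact h1 ▸ h2

/-! ### The randomization test -/

/-- The observed value is the strict maximum, so it can only be the order statistic of rank `K + 1`.
Since `α (K + 1) ≥ 1`, the critical rank is at most `K`. -/
theorem randomizationRejects_of_forall_lt {V G : Type*} {f : V → ℝ} {act : G → V → V} {α : ℝ}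
    {K : ℕ} (hK : 1 / ((K : ℝ) + 1) ≤ α) {x : V} {g : Fin K → G}
    (h : ∀ i, f (act (g i) x) < f x) : RandomizationRejects f act α x g := by
  unfold RandomizationRejects
  set v : Fin (K + 1) → ℝ := Fin.cons (f x) fun i : Fin K => f (act (g i) x) with hv
  have hlt : ∀ r : Fin (K + 1), r ≠ 0 → v r < f x := by
    intro r hr
    obtain ⟨i, rfl⟩ := Fin.exists_succ_eq.mpr hr
    simpa [hv] using h i
  have hk : ⌈(1 - α) * ((K : ℝ) + 1)⌉₊ ≤ K := by
    rw [Nat.ceil_le]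
    rw [div_le_iff₀ (by positivity)] at hK
    linarith
  rcases hk' : ⌈(1 - α) * ((K : ℝ) + 1)⌉₊ with _ | j
  -- Rank `0` occurs when `α ≥ 1`; the critical value is then `-∞`.
  · exact EReal.bot_lt_coe _
  · have hj : j + 1 < K + 1 := by omega
    rw [orderStat, dif_pos (by omega), EReal.coe_lt_coe_iff]
    -- If the observed value sat at sorted position `j`, the entry at position `j + 1` would be at
    -- least as large, yet it comes from another index and is strictly smaller.
    refine hlt _ fun h0 => ?_
    have hmono : v (Tuple.sort v ⟨j, by omega⟩) ≤ v (Tuple.sort v ⟨j + 1, hj⟩) :=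
      Tuple.monotone_sort v (Fin.mk_le_mk.mpr (Nat.le_succ j))
    have hne : Tuple.sort v ⟨j + 1, hj⟩ ≠ 0 := by
      rw [← h0]
      exact fun heq => by simpa using (Tuple.sort v).injective heq
    have := hlt _ hne
    rw [h0] at hmono
    exact absurd (this.trans_le' hmono) (lt_irrefl _)

/-- A lower bound for the power of the operator norm randomization test. -/
theorem one_sub_le_rejectionProb {Y : Type*} [MeasurableSpace Y] (P : Measure Y)
    [IsProbabilityMeasure P] {n p : ℕ} (hn : 0 < n) (hp : 0 < p)
    {N : Y → Matrix (Fin n) (Fin p) ℝ} (hN : ∀ i j, Measurable fun ω => N ω i j)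
    (hsph : HasIndepSphericalColumns N P) {α : ℝ} {K : ℕ} (hK : 1 / ((K : ℝ) + 1) ≤ α)
    {s : Matrix (Fin n) (Fin p) ℝ} {t : ℝ}
    (hs : 2 * (maxColNorm s + 2 * t) * ((√n + √p) / √n) < matOpNorm s) :
    1 - (1 - P {ω | maxColNorm (N ω) ≤ t} +
        (K + 1) * ENNReal.ofReal ((9 / 10) ^ ⌈√((n : ℝ) * p)⌉₊)) ≤ rejectionProb P N α K s := by
  set δ := ENNReal.ofReal ((9 / 10) ^ ⌈√((n : ℝ) * p)⌉₊) with hδ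
  set c := (√n + √p) / √n with hc
  set ν := Measure.pi fun _ : Fin K => haarColumns n p with hν
  let E : Set Y := {ω | maxColNorm (N ω) ≤ t}
  have hE : MeasurableSet E := measurableSet_le (measurable_maxColNorm_comp hN) measurable_const
  let F : Set Y := {ω | maxColNorm (N ω) ≤ t ∧ 2 * t * c < matOpNorm (N ω)}
  let H : Set (Y × (Fin p → OrthGroup n)) := {z | maxColNorm (N z.1) ≤ t ∧
    2 * (maxColNorm s + t) * c < matOpNorm (rotateColumns z.2 (s + N z.1))}
  have hH : MeasurableSet H := by
    have hX : ∀ i j, Measurable fun z : Y × (Fin p → OrthGroup n) => (s + N z.1) i j :=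
      fun i j => measurable_const.add ((hN i j).comp measurable_fst)
    exact (measurableSet_le ((measurable_maxColNorm_comp hN).comp measurable_fst)
      measurable_const).inter (measurableSet_lt measurable_const
        (measurable_matOpNorm_comp (measurable_rotateColumns_comp hX measurable_snd)))
  have hHle : P.prod (haarColumns n p) H ≤ δ := by
    rw [Measure.prod_apply hH]
    calc _ ≤ ∫⁻ _ω, δ ∂P := by
          refine lintegral_mono fun ω => ?_
          by_cases hω : maxColNorm (N ω) ≤ t
          · exact (measure_mono fun g hg => hg.2).trans (haarColumns_lt_matOpNorm_le hn hp
              ((maxColNorm_add_le s (N ω)).trans (add_le_add_right hω _)))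
          · have : Prod.mk ω ⁻¹' H = ∅ := Set.eq_empty_of_forall_notMem fun g hg => hω hg.1
            rw [this, measure_empty]
            exact zero_le
      _ = δ := by simp
  have hHk : ∀ k : Fin K, P.prod ν {z | (z.1, z.2 k) ∈ H} ≤ δ := by
    intro k
    -- The union bound over `k` needs only the marginal law of each pair `(ω, g k)`.
    have hmp : MeasurePreserving (Prod.map id fun g : Fin K → Fin p → OrthGroup n => g k)
        (P.prod ν) (P.prod (haarColumns n p)) :=
      (MeasurePreserving.id P).prod (measurePreserving_eval (fun _ : Fin K => haarColumns n p) k)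
    exact (hmp.measure_preimage hH.nullMeasurableSet).trans_le hHle
  have hcover : (Set.univ : Set (Y × (Fin K → Fin p → OrthGroup n))) ⊆
      {z | RandomizationRejects matOpNorm rotateColumns α (s + N z.1) z.2} ∪
        ((Eᶜ ×ˢ Set.univ) ∪ (F ×ˢ Set.univ ∪ ⋃ k, {z | (z.1, z.2 k) ∈ H})) := by
    rintro z -
    by_contra hz
    simp only [Set.mem_union, Set.mem_prod, Set.mem_univ, and_true, Set.mem_iUnion, not_or,
      not_exists, Set.mem_compl_iff, not_not] at hz
    obtain ⟨hrej, hzE, hzF, hzH⟩ := hz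
    refine hrej (randomizationRejects_of_forall_lt hK fun k => ?_)
    -- Of the two copies of `t` in `hs`, one pays for subtracting `‖N‖` from `‖s‖`, the other for
    -- the noise in the columns of the rotated data.
    have h1 : matOpNorm (N z.1) ≤ 2 * t * c := not_lt.mp fun hlt => hzF ⟨hzE, hlt⟩
    have h2 : matOpNorm (rotateColumns (z.2 k) (s + N z.1)) ≤ 2 * (maxColNorm s + t) * c :=
      not_lt.mp fun hlt => hzH k ⟨hzE, hlt⟩
    have h3 := matOpNorm_sub_le_matOpNorm_add s (N z.1)
    linarith
  have hF : P F ≤ δ := hsph.measure_lt_matOpNorm_le hn hp hN t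
  rw [tsub_le_iff_right]
  calc (1 : ENNReal) = P.prod ν Set.univ := measure_univ.symm
    _ ≤ rejectionProb P N α K s + (P.prod ν (Eᶜ ×ˢ Set.univ) + (P.prod ν (F ×ˢ Set.univ) +
          P.prod ν (⋃ k, {z | (z.1, z.2 k) ∈ H}))) := by
        refine (measure_mono hcover).trans ((measure_union_le _ _).trans (add_le_add_right ?_ _))
        exact (measure_union_le _ _).trans (add_le_add_right (measure_union_le _ _) _)
    _ ≤ rejectionProb P N α K s + (1 - P E + (δ + K * δ)) := by
        rw [Measure.prod_prod, Measure.prod_prod, measure_univ, mul_one, mul_one,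
          prob_compl_eq_one_sub hE]
        gcongr
        refine (measure_iUnion_fintype_le _ _).trans ?_
        calc ∑ k : Fin K, P.prod ν {z | (z.1, z.2 k) ∈ H} ≤ ∑ _k : Fin K, δ :=
              Finset.sum_le_sum fun k _ => hHk k
          _ = K * δ := by simp
    _ = _ := by rw [add_mul, one_mul, add_comm δ]

/-! ### Consistency. -/

theorem mainTheorem4 {Ω : ℕ → Type*} [∀ m, MeasurableSpace (Ω m)]
    (P : ∀ m, Measure (Ω m)) [∀ m, IsProbabilityMeasure (P m)]
    (n p : ℕ → ℕ) (hn : Tendsto n atTop atTop) (hp : Tendsto p atTop atTop)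
    (c₀ c₁ : ℝ) (hc₀ : 0 < c₀) (hc₁ : c₀ < c₁)
    (hnp : ∀ᶠ m in atTop, c₀ ≤ (n m : ℝ) / (p m : ℝ) ∧ (n m : ℝ) / (p m : ℝ) ≤ c₁)
    (N : ∀ m, Ω m → Matrix (Fin (n m)) (Fin (p m)) ℝ)
    (hN : ∀ m i j, Measurable fun ω => N m ω i j)
    (hsph : ∀ m, HasIndepSphericalColumns (N m) (P m))
    (α : ℝ) (hα : α ≤ 1) (K : ℕ) (hK : 1 / ((K : ℝ) + 1) ≤ α)
    (Θ : ∀ m, Set (Matrix (Fin (n m)) (Fin (p m)) ℝ))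
    (t : ℕ → ℝ)
    (ht : Tendsto (fun m => P m {ω | maxColNorm (N m ω) ≤ t m}) atTop (𝓝 1))
    (hs : ∀ s : ∀ m, Matrix (Fin (n m)) (Fin (p m)) ℝ, (∀ m, s m ∈ Θ m) →
      (2 : EReal) < liminf (fun m =>
        (((matOpNorm (s m) / (√(n m : ℝ) + √(p m : ℝ))) /
          ((maxColNorm (s m) + 2 * t m) / √(n m : ℝ)) : ℝ) : EReal)) atTop) :
    IsConsistentAgainst P N α K Θ := by
  intro s hsΘ
  have hratio := eventually_lt_of_lt_liminf (hs s hsΘ)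
  -- An event of positive probability is nonempty, and column norms are nonnegative.
  have ht0 : ∀ᶠ m in atTop, 0 ≤ t m := by
    filter_upwards [ht.eventually (lt_mem_nhds zero_lt_one)] with m hm
    obtain ⟨ω, hω⟩ := nonempty_of_measure_ne_zero hm.ne'
    exact (maxColNorm_nonneg _).trans hω
  have hbound : ∀ᶠ m in atTop, 1 - (1 - P m {ω | maxColNorm (N m ω) ≤ t m} +
      (K + 1) * ENNReal.ofReal ((9 / 10) ^ ⌈√((n m : ℝ) * p m)⌉₊)) ≤
        rejectionProb (P m) (N m) α K (s m) := by
    filter_upwards [hratio, ht0, hn.eventually_gt_atTop 0, hp.eventually_gt_atTop 0]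
      with m hm htm hnm hpm
    refine one_sub_le_rejectionProb (P m) hnm hpm (hN m) (hsph m) hK ?_
    have hn' : (0 : ℝ) < √(n m) := Real.sqrt_pos.mpr (by exact_mod_cast hnm)
    have hc : 0 < √(n m : ℝ) + √(p m) := by positivity
    have hD : 0 ≤ maxColNorm (s m) + 2 * t m := by linarith [maxColNorm_nonneg (s m)]
    have hm' : (2 : ℝ) < (matOpNorm (s m) / (√(n m : ℝ) + √(p m : ℝ))) /
        ((maxColNorm (s m) + 2 * t m) / √(n m : ℝ)) :=
      EReal.coe_lt_coe_iff.mp hm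
    -- A zero denominator would make the quotient `0`, which does not exceed `2`.
    have hD' : 0 < (maxColNorm (s m) + 2 * t m) / √(n m : ℝ) := by
      refine lt_of_le_of_ne (by positivity) fun h0 => ?_
      rw [← h0, div_zero] at hm'
      linarith
    rw [lt_div_iff₀ hD', lt_div_iff₀ hc] at hm'
    calc _ = 2 * ((maxColNorm (s m) + 2 * t m) / √(n m : ℝ)) * (√(n m : ℝ) + √(p m : ℝ)) := by ring
      _ < _ := hm'
  have hexp : Tendsto (fun m => ⌈√((n m : ℝ) * p m)⌉₊) atTop atTop := by
    refine tendsto_nat_ceil_atTop.comp (Real.tendsto_sqrt_atTop.comp ?_)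
    exact (tendsto_natCast_atTop_atTop.comp hn).atTop_mul_atTop₀
      (tendsto_natCast_atTop_atTop.comp hp)
  have hδ : Tendsto (fun m => ENNReal.ofReal ((9 / 10) ^ ⌈√((n m : ℝ) * p m)⌉₊)) atTop (𝓝 0) := by
    rw [← ENNReal.ofReal_zero]
    exact ENNReal.tendsto_ofReal
      ((tendsto_pow_atTop_nhds_zero_of_lt_one (by norm_num) (by norm_num)).comp hexp)
  have hlim : Tendsto (fun m => 1 - (1 - P m {ω | maxColNorm (N m ω) ≤ t m} +
      (K + 1) * ENNReal.ofReal ((9 / 10) ^ ⌈√((n m : ℝ) * p m)⌉₊))) atTop (𝓝 1) := by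
    have h1 := ENNReal.Tendsto.sub (tendsto_const_nhds (x := (1 : ENNReal))) ht
      (Or.inl ENNReal.one_ne_top)
    have h2 := ENNReal.Tendsto.const_mul (a := (K + 1 : ENNReal)) hδ
      (Or.inr (by simp))
    have h3 := ENNReal.Tendsto.sub (tendsto_const_nhds (x := (1 : ENNReal))) (h1.add h2)
      (Or.inl ENNReal.one_ne_top)
    simpa using h3
  exact tendsto_of_tendsto_of_tendsto_of_le_of_le' hlim tendsto_const_nhds hbound
    (Eventually.of_forall fun m => prob_le_one)
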